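/- All graphs are finite and simple, and $\mathbb{N}=\{0,1,2,\dots\}$. A DP-cover of a graph $G$ is a pair $(L,H)$, where $H$ is a graph and $L$ assigns to each vertex $v$ of $G$ a set $L(v)\subseteq V(H)$, such that the sets $L(v)$ are independent in $H$ and partition $V(H)$, the edges of $H$ between $L(u)$ and $L(v)$ form a matching for every edge $uv$ of $G$, and $H$ has no other edges. The graph $G$ is $(L,H)$-colorable if there is an independent set $T$ of $H$ that contains exactly one vertex from each $L(v)$. For a graph $G$ with a fixed linear order on $V(G)$ and for $k\in\mathbb{N}$, the random $k$-fold cover $\mathcal{H}(G,k)$ is the cover with $L(v)=\{v\}\times\{1,\dots,k\}$ in which, for each edge $e=uv$ of $G$ with $u<v$, the vertex $(u,i)$ is joined to $(v,\sigma_e(i))$ for $i=1,\dots,k$, where the $\sigma_e$ $(e\in E(G))$ are independent uniformly random permutations of $\{1,\dots,k\}$. Let $K_n$ be the complete graph on $n$ vertices. Then $t(n)=\dfrac{n}{2\ln n}$ is a sharp DP-threshold function for the sequence $(K_n)_{n\in\mathbb{N}}$. That is, for every $\epsilon>0$ and every sequence $(k_n)_{n\in\mathbb{N}}$ of natural numbers: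 1. if $k_n\le(1-\epsilon)\,\dfrac{n}{2\ln n}$ for all large enough $n$, then $$\lim_{n\to\infty}\mathbb{P}\bigl(K_n\text{ is }\mathcal{H}(K_n,k_n)\text{-colorable}\bigr)=0;$$ 2. if $k_n\ge(1+\epsilon)\,\dfrac{n}{2\ln n}$ for all large enough $n$, then $$\lim_{n\to\infty}\mathbb{P}\bigl(K_n\text{ is }\mathcal{H}(K_n,k_n)\text{-colorable}\bigr)=1.$$ -/

import Mathlib

open Filter Topology

/-- A DP-cover `(L, H)` of a graph `G`, where `H` is a graph with vertex set `W`. Lists are allowed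
to be empty, so that `0`-fold covers exist. -/
structure DPCover {V : Type*} (G : SimpleGraph V) (W : Type*) where
  /-- The list of each vertex of `G`. -/
  L : V → Set W
  /-- The cover graph. -/
  H : SimpleGraph W
  /-- The lists partition the vertex set of `H`. -/
  partition : ∀ x : W, ∃! v : V, x ∈ L v
  /-- Every list is an independent set of `H`. -/
  indep : ∀ v : V, H.IsIndepSet (L v)
  /-- The edges of `H` between the lists of two adjacent vertices form a matching. (The condition
  for `(v, u)` says that a vertex of `L v` has at most one neighbor in `L u`.) -/
  matching : ∀ u v : V, G.Adj u v → ∀ x ∈ L u, ∀ y ∈ L v, ∀ z ∈ L v,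
    H.Adj x y → H.Adj x z → y = z
  /-- Every edge of `H` joins the lists of two adjacent vertices of `G`. -/
  edges : ∀ x y : W, H.Adj x y → ∃ u v : V, G.Adj u v ∧ x ∈ L u ∧ y ∈ L v

namespace DPCover

variable {V W : Type*} {G : SimpleGraph V}

/-- A transversal is a set of vertices of `H` with exactly one vertex in each list. -/
def IsTransversal (C : DPCover G W) (T : Set W) : Prop :=
  ∀ v : V, ∃! x : W, x ∈ C.L v ∧ x ∈ T

/-- `G` is `(L, H)`-colorable if the cover has an independent transversal. -/
def Colorable (C : DPCover G W) : Prop :=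
  ∃ T : Set W, C.IsTransversal T ∧ C.H.IsIndepSet T

end DPCover

/-- The full `k`-fold cover of `G` given by a permutation of the `k` colors for every edge of `G`:
the list of `v` is `{v} × [k]`, and for an edge `e = uv` with `u < v` the vertex `(u, i)` is joined
to `(v, σ e i)`. -/
def permCover {V : Type*} [LinearOrder V] (G : SimpleGraph V) (k : ℕ)
    (σ : G.edgeSet → Equiv.Perm (Fin k)) : DPCover G (V × Fin k) where
  L v := {x | x.1 = v}
  H :=
    { Adj := fun x y =>
        (∃ h : G.Adj x.1 y.1, x.1 < y.1 ∧ σ ⟨s(x.1, y.1), h⟩ x.2 = y.2) ∨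
        (∃ h : G.Adj y.1 x.1, y.1 < x.1 ∧ σ ⟨s(y.1, x.1), h⟩ y.2 = x.2)
      symm := ⟨fun _ _ h => h.symm⟩
      loopless := ⟨fun x h => by
        rcases h with ⟨h, -⟩ | ⟨h, -⟩ <;> exact G.loopless.irrefl _ h⟩ }
  partition x := ⟨x.1, rfl, fun _ h => h.symm⟩
  indep v := by
    rintro ⟨a, i⟩ ha ⟨b, j⟩ hb - h
    simp only [Set.mem_ofPred_eq] at ha hb
    subst ha hb
    rcases h with ⟨h, -⟩ | ⟨h, -⟩ <;> exact G.loopless.irrefl _ h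
  matching u v _ := by
    rintro ⟨a, i⟩ ha ⟨b, j⟩ hb ⟨c, l⟩ hc h₁ h₂
    simp only [Set.mem_ofPred_eq] at ha hb hc
    subst ha hb hc
    rcases h₁ with ⟨_, hlt, h₁⟩ | ⟨_, hlt, h₁⟩ <;> rcases h₂ with ⟨_, hlt', h₂⟩ | ⟨_, hlt', h₂⟩
    · exact Prod.ext rfl (h₁.symm.trans h₂)
    · exact absurd hlt' hlt.asymm
    · exact absurd hlt' hlt.asymm
    · exact Prod.ext rfl (Equiv.injective _ (h₁.trans h₂.symm))
  edges x y h := by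
    rcases h with ⟨h, -⟩ | ⟨h, -⟩
    · exact ⟨x.1, y.1, h, rfl, rfl⟩
    · exact ⟨x.1, y.1, h.symm, rfl, rfl⟩

/-- The random `k`-fold cover of `G`: the permutations on the edges of `G` are chosen uniformly at
random from all `(k!) ^ m` families, `m` being the number of edges. (Different families give
different covers, so this is the uniform distribution on the set of all these covers.) -/
noncomputable def randomCover {V : Type*} [LinearOrder V] [Finite V] (G : SimpleGraph V) (k : ℕ) :
    PMF (DPCover G (V × Fin k)) :=
  letI : Fintype (G.edgeSet → Equiv.Perm (Fin k)) := Fintype.ofFinite _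
  (PMF.uniformOfFintype (G.edgeSet → Equiv.Perm (Fin k))).map (permCover G k)

/-- The probability that `G` is colorable from a random `k`-fold cover. -/
noncomputable def probDPColorable {V : Type*} [LinearOrder V] [Finite V] (G : SimpleGraph V)
    (k : ℕ) : ℝ :=
  ((randomCover G k).toOuterMeasure {C | C.Colorable}).toReal

/-- The sequence of graphs `G` is `κ`-DP-colorable with high probability. -/
def DPColorableWhp {V : ℕ → Type*} [∀ n, LinearOrder (V n)] [∀ n, Finite (V n)]
    (G : ∀ n, SimpleGraph (V n)) (κ : ℕ → ℕ) : Prop :=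
  Tendsto (fun n => probDPColorable (G n) (κ n)) atTop (𝓝 1)

/-- The sequence of graphs `G` is non-`κ`-DP-colorable with high probability. -/
def NonDPColorableWhp {V : ℕ → Type*} [∀ n, LinearOrder (V n)] [∀ n, Finite (V n)]
    (G : ∀ n, SimpleGraph (V n)) (κ : ℕ → ℕ) : Prop :=
  Tendsto (fun n => probDPColorable (G n) (κ n)) atTop (𝓝 0)

/-- `t` is a sharp DP-threshold function for the sequence of graphs `G`. -/
def IsSharpDPThreshold {V : ℕ → Type*} [∀ n, LinearOrder (V n)] [∀ n, Finite (V n)]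
    (G : ∀ n, SimpleGraph (V n)) (t : ℕ → ℝ) : Prop :=
  ∀ ε : ℝ, 0 < ε → ∀ κ : ℕ → ℕ,
    ((∀ᶠ n in atTop, (κ n : ℝ) ≤ (1 - ε) * t n) → NonDPColorableWhp G κ) ∧
    ((∀ᶠ n in atTop, (1 + ε) * t n ≤ (κ n : ℝ)) → DPColorableWhp G κ)

/-! Let X be the number of independent transversals, i.e. of maps `f` meeting no matching edge, and
put p = 1 - 1/k, M = n(n-1)/2. For fixed `f` each edge is avoided independently with probability p,
so E X = k^n p^M, which is about exp(n ln k - n²/(2k)). The sign of this exponent changes near k =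
n/(2 ln n). Below the threshold E X tends to 0, and Markov's inequality finishes
(`probDPColorable_le`). Above it, Cauchy-Schwarz gives P(X > 0) ≥ (E X)²/E X². Two maps that agree
on s vertices are positively correlated essentially only along the at most s(s-1)/2 edges inside the
agreement set, each costing a factor 1/p; every other edge costs at most 1 + 1/(k-1)³. Hence E X²/(E
X)² is at most (1 + 1/(k-1)³)^M times the mean of p^(-s(s-1)/2) for s binomial with parameters n and
1/k (`one_le_probDPColorable_mul`). The mean tends to 1: for s ≤ (ln n)² the weight is close to 1,
and larger s contribute o(1) (`second_moment_sum_le`). -/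

/-! ### Counting permutations with one or two prescribed or forbidden values -/

open Finset in
theorem Equiv.Perm.mul_card_filter_apply_eq {k : ℕ} (a b : Fin k) :
    k * #{π : Equiv.Perm (Fin k) | π a = b} = k.factorial := by
  have h : ∀ b' : Fin k, #{π : Equiv.Perm (Fin k) | π a = b'} =
      #{π : Equiv.Perm (Fin k) | π a = b} := fun b' => by
    -- Composing with the transposition of b and b' is a bijection between the two fibres, so all k
    -- fibres have equal size.
    refine card_bij' (fun π _ => Equiv.swap b b' * π) (fun π _ => Equiv.swap b b' * π) ?_ ?_ ?_ ?_
    all_goals simp +contextual [← mul_assoc]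
  have h2 := card_eq_sum_card_fiberwise (s := (univ : Finset (Equiv.Perm (Fin k)))) (t := univ)
    (f := fun π => π a) (by simp)
  simp only [h, sum_const, card_univ, Fintype.card_fin, Fintype.card_perm, smul_eq_mul] at h2
  exact h2.symm

open Finset in
theorem Equiv.Perm.mul_card_filter_apply_eq_apply_eq {k : ℕ} {a b c d : Fin k} (hac : a ≠ c)
    (hbd : b ≠ d) :
    (k - 1) * #{π : Equiv.Perm (Fin k) | π a = b ∧ π c = d} =
      #{π : Equiv.Perm (Fin k) | π a = b} := by
  have h : ∀ d' ∈ univ.erase b, #{π ∈ ({π | π a = b} : Finset (Equiv.Perm (Fin k))) | π c = d'} =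
      #{π : Equiv.Perm (Fin k) | π a = b ∧ π c = d} := fun d' hd' => by
    have hd' : d' ≠ b := by simpa using hd'
    rw [filter_filter]
    refine card_bij' (fun π _ => Equiv.swap d d' * π) (fun π _ => Equiv.swap d d' * π) ?_ ?_ ?_ ?_
    all_goals simp +contextual [← mul_assoc, Equiv.swap_apply_of_ne_of_ne hbd hd'.symm]
  have h2 := card_eq_sum_card_fiberwise (s := ({π | π a = b} : Finset (Equiv.Perm (Fin k))))
    (t := univ.erase b) (f := fun π => π c) (by
      intro π hπ
      have hπ : π a = b := by simpa using hπ
      simp only [coe_erase, coe_univ, Set.mem_sdiff, Set.mem_univ, true_and, Set.mem_singleton_iff]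
      exact fun h => hac (π.injective (hπ.trans h.symm)))
  rw [sum_congr rfl h] at h2
  simpa using h2.symm

open Finset in
theorem Equiv.Perm.card_filter_apply_eq_real {k : ℕ} (a b : Fin k) :
    (#{π : Equiv.Perm (Fin k) | π a = b} : ℝ) = k.factorial * (1 / k) := by
  have hk : (k : ℝ) ≠ 0 := by exact_mod_cast (Fin.pos a).ne'
  have h := Equiv.Perm.mul_card_filter_apply_eq a b
  rw [← h]; push_cast; field_simp

open Finset in
theorem Equiv.Perm.card_filter_apply_ne {k : ℕ} (a b : Fin k) :
    (#{π : Equiv.Perm (Fin k) | π a ≠ b} : ℝ) = k.factorial * (1 - 1 / k) := by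
  have h := card_filter_add_card_filter_not (s := (univ : Finset (Equiv.Perm (Fin k))))
    (fun π => π a = b)
  rw [card_univ, Fintype.card_perm, Fintype.card_fin] at h
  rw [mul_sub, ← Equiv.Perm.card_filter_apply_eq_real a b, ← h]
  push_cast; ring

-- For distinct constraints the proportion is 1 - 2/k if they share a row or a column, and 1 - 2/k +
-- 1/(k(k-1)) = (1 - 1/k)²(1 + 1/(k-1)³) otherwise. Coinciding constraints give 1 - 1/k, one factor
-- fewer; this is what the conditional inverse restores.
open Finset in
theorem Equiv.Perm.card_filter_apply_ne_apply_ne_le {k : ℕ} (hk : 2 ≤ k) (a b c d : Fin k) :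
    (#{π : Equiv.Perm (Fin k) | π a ≠ b ∧ π c ≠ d} : ℝ) ≤
      k.factorial * ((1 - 1 / k) ^ 2 * (1 + 1 / ((k : ℝ) - 1) ^ 3) *
        if a = c ∧ b = d then (1 - 1 / (k : ℝ))⁻¹ else 1) := by
  have hk2 : (2 : ℝ) ≤ k := by exact_mod_cast hk
  have hk0 : (0 : ℝ) < k := by linarith
  have hk1 : (0 : ℝ) < (k : ℝ) - 1 := by linarith
  have hf : (0 : ℝ) < k.factorial := by positivity
  have hp : 1 - 1 / (k : ℝ) = (k - 1) / k := by field_simp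
  have hr : (1 - 1 / (k : ℝ)) ^ 2 * (1 + 1 / ((k : ℝ) - 1) ^ 3) =
      1 - 2 * (1 / k) + 1 / k * (1 / (k - 1)) := by
    field_simp; ring
  have hunion : (#{π : Equiv.Perm (Fin k) | π a ≠ b ∧ π c ≠ d} : ℝ) =
      k.factorial - k.factorial * (1 / k) - k.factorial * (1 / k) +
        #{π : Equiv.Perm (Fin k) | π a = b ∧ π c = d} := by
    have h1 := card_filter_add_card_filter_not (s := (univ : Finset (Equiv.Perm (Fin k))))
      (fun π => π a = b ∨ π c = d)
    have h2 := card_union_add_card_inter ({π : Equiv.Perm (Fin k) | π a = b} : Finset _)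
      ({π : Equiv.Perm (Fin k) | π c = d} : Finset _)
    rw [← filter_or, ← filter_and] at h2
    simp only [not_or, card_univ, Fintype.card_perm, Fintype.card_fin] at h1
    have h1' : ((_ + _ : ℕ) : ℝ) = _ := congrArg (Nat.cast (R := ℝ)) h1
    have h2' : ((_ + _ : ℕ) : ℝ) = _ := congrArg (Nat.cast (R := ℝ)) h2
    push_cast at h1' h2'
    rw [Equiv.Perm.card_filter_apply_eq_real, Equiv.Perm.card_filter_apply_eq_real] at h2'
    linarith
  by_cases hac : a = c <;> by_cases hbd : b = d
  · subst hac hbd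
    simp only [and_self, if_true]
    rw [Equiv.Perm.card_filter_apply_ne, hp]
    gcongr
    have : (0 : ℝ) < 1 / ((k : ℝ) - 1) ^ 3 := by positivity
    have hq : 0 < ((k : ℝ) - 1) / k := by positivity
    calc ((k : ℝ) - 1) / k ≤ (k - 1) / k * (1 + 1 / ((k : ℝ) - 1) ^ 3) := by nlinarith
      _ = _ := by field_simp
  all_goals
    rw [if_neg (by tauto), mul_one, hr, hunion]
  · have h0 : ({π : Equiv.Perm (Fin k) | π a = b ∧ π c = d} : Finset _) = ∅ := by
      ext π; simp only [mem_filter, mem_univ, true_and, notMem_empty, iff_false]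
      rintro ⟨h, h'⟩; exact hbd (h.symm.trans ((congrArg π hac).trans h'))
    rw [h0, card_empty]
    have : (0 : ℝ) < k.factorial * (1 / k * (1 / ((k : ℝ) - 1))) := by positivity
    push_cast
    linarith
  · have h0 : ({π : Equiv.Perm (Fin k) | π a = b ∧ π c = d} : Finset _) = ∅ := by
      ext π; simp only [mem_filter, mem_univ, true_and, notMem_empty, iff_false]
      rintro ⟨h, h'⟩; exact hac (π.injective (h.trans (hbd.trans h'.symm)))
    rw [h0, card_empty]
    have : (0 : ℝ) < k.factorial * (1 / k * (1 / ((k : ℝ) - 1))) := by positivity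
    push_cast
    linarith
  · have h := congrArg (Nat.cast (R := ℝ)) (Equiv.Perm.mul_card_filter_apply_eq_apply_eq hac hbd)
    rw [Nat.cast_mul, Equiv.Perm.card_filter_apply_eq_real, Nat.cast_sub (by omega)] at h
    have h' : (#{π : Equiv.Perm (Fin k) | π a = b ∧ π c = d} : ℝ) =
        k.factorial * (1 / k * (1 / ((k : ℝ) - 1))) := by
      rw [← mul_assoc, ← h]; push_cast; field_simp
    rw [h']
    linarith

/-! ### Colorings as maps, and the probability as a count -/

/-- The choice `f` of one color for each vertex is an independent transversal of the cover given
by `σ`. -/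
def IsPermColoring {V : Type*} [LinearOrder V] {G : SimpleGraph V} {k : ℕ}
    (σ : G.edgeSet → Equiv.Perm (Fin k)) (f : V → Fin k) : Prop :=
  ∀ e : G.edgeSet, σ e (f e.1.inf) ≠ f e.1.sup

theorem isPermColoring_iff_of_lt {V : Type*} [LinearOrder V] {G : SimpleGraph V} {k : ℕ}
    {σ : G.edgeSet → Equiv.Perm (Fin k)} {f : V → Fin k} :
    IsPermColoring σ f ↔ ∀ u v (h : G.Adj u v), u < v → σ ⟨s(u, v), h⟩ (f u) ≠ f v := by
  constructor
  · intro H u v h huv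
    have := H ⟨s(u, v), h⟩
    simpa [Sym2.inf_mk, Sym2.sup_mk, inf_eq_left.2 huv.le, sup_eq_right.2 huv.le] using this
  · rintro H ⟨e, he⟩
    induction e using Sym2.inductionOn with
    | hf u v =>
      rcases lt_trichotomy u v with huv | huv | huv
      · simpa [Sym2.inf_mk, Sym2.sup_mk, inf_eq_left.2 huv.le, sup_eq_right.2 huv.le]
          using H u v he huv
      · exact absurd huv (G.ne_of_adj he)
      · have := H v u (G.adj_symm he) huv
        simp only [Sym2.inf_mk, Sym2.sup_mk, inf_eq_right.2 huv.le, sup_eq_left.2 huv.le]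
        have hσ : σ ⟨s(u, v), he⟩ = σ ⟨s(v, u), G.adj_symm he⟩ :=
          congrArg σ (Subtype.ext Sym2.eq_swap)
        rwa [hσ]

theorem colorable_permCover_iff {V : Type*} [LinearOrder V] {G : SimpleGraph V} {k : ℕ}
    (σ : G.edgeSet → Equiv.Perm (Fin k)) :
    (permCover G k σ).Colorable ↔ ∃ f : V → Fin k, IsPermColoring σ f := by
  simp only [isPermColoring_iff_of_lt]
  constructor
  · rintro ⟨T, hT, hind⟩
    have h1 : ∀ v, ∃ i, (v, i) ∈ T := fun v => by
      obtain ⟨⟨w, i⟩, ⟨hx, hxT⟩, -⟩ := hT v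
      have hx : w = v := hx
      exact ⟨i, hx ▸ hxT⟩
    choose f hf using h1
    refine ⟨f, fun u v h huv heq => ?_⟩
    exact hind (hf u) (hf v) (fun h' => huv.ne (congrArg Prod.fst h')) (Or.inl ⟨h, huv, heq⟩)
  · rintro ⟨f, hf⟩
    refine ⟨{x | f x.1 = x.2}, fun v => ⟨(v, f v), ⟨rfl, rfl⟩, ?_⟩, ?_⟩
    · rintro ⟨w, i⟩ ⟨hw, hi⟩
      have hw : w = v := hw
      have hi : f w = i := hi
      subst hw hi
      rfl
    · rintro ⟨u, i⟩ hi ⟨v, j⟩ hj -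
      have hi : f u = i := hi
      have hj : f v = j := hj
      subst hi hj
      rintro (⟨h, huv, heq⟩ | ⟨h, huv, heq⟩) <;> exact hf _ _ h huv heq

open Classical in
theorem probDPColorable_eq {V : Type*} [LinearOrder V] [Finite V] (G : SimpleGraph V) [Fintype V]
    (k : ℕ) :
    probDPColorable G k =
      (Finset.card {σ : G.edgeSet → Equiv.Perm (Fin k) | ∃ f, IsPermColoring σ f} : ℝ) /
        (k.factorial : ℝ) ^ Fintype.card G.edgeSet := by
  unfold probDPColorable randomCover
  rw [Subsingleton.elim (Fintype.ofFinite (G.edgeSet → Equiv.Perm (Fin k))) inferInstance,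
    PMF.toOuterMeasure_map_apply, PMF.toOuterMeasure_uniformOfFintype_apply,
    ENNReal.toReal_div, ENNReal.toReal_natCast, ENNReal.toReal_natCast]
  congr 1
  · rw [← Fintype.card_subtype]
    norm_cast
    refine Fintype.card_congr (Equiv.subtypeEquivRight fun σ => ?_)
    exact colorable_permCover_iff σ
  · norm_cast
    rw [← Nat.card_eq_fintype_card]
    simp [Fintype.card_perm, Nat.card_eq_fintype_card]

/-! ### First and second moments for a general graph -/

section moments

open Finset Classical

variable {V : Type*} [LinearOrder V] [Fintype V] (G : SimpleGraph V) (k : ℕ)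

theorem card_isPermColoring (f : V → Fin k) :
    (#{σ : G.edgeSet → Equiv.Perm (Fin k) | IsPermColoring σ f} : ℝ) =
      (k.factorial : ℝ) ^ Fintype.card G.edgeSet * (1 - 1 / k) ^ Fintype.card G.edgeSet := by
  -- Independence of the edges: the event is a product set, so its size is a product over the edges.
  have h : ({σ : G.edgeSet → Equiv.Perm (Fin k) | IsPermColoring σ f} : Finset _) =
      Fintype.piFinset fun e : G.edgeSet =>
        ({π | π (f e.1.inf) ≠ f e.1.sup} : Finset (Equiv.Perm (Fin k))) := by
    ext σ; simp [IsPermColoring]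
  rw [h, Fintype.card_piFinset, Nat.cast_prod,
    prod_congr rfl fun e _ => Equiv.Perm.card_filter_apply_ne _ _, prod_const, card_univ, mul_pow]

theorem card_edgeSet_filter_le (S : Finset V) :
    #{e : G.edgeSet | e.1.inf ∈ S ∧ e.1.sup ∈ S} ≤ (#S).choose 2 := by
  rw [← Sym2.card_image_offDiag, ← card_map (Function.Embedding.subtype _)]
  refine card_le_card fun e he => ?_
  obtain ⟨⟨e, hadj⟩, h, rfl⟩ := Finset.mem_map.1 he
  replace h := (mem_filter.1 h).2
  clear he
  induction e using Sym2.inductionOn with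
  | hf u v =>
    have huv : u ≠ v := G.ne_of_adj hadj
    simp only [Sym2.inf_mk, Sym2.sup_mk] at h
    refine mem_image.2 ⟨(u, v), ?_, rfl⟩
    rw [mem_offDiag]
    rcases le_total u v with hle | hle
    · rw [inf_eq_left.2 hle, sup_eq_right.2 hle] at h
      exact ⟨h.1, h.2, huv⟩
    · rw [inf_eq_right.2 hle, sup_eq_left.2 hle] at h
      exact ⟨h.2, h.1, huv⟩

/-- The two constraints on an edge coincide exactly when `f` and `g` agree at both ends, so only
edges inside the agreement set carry the extra factor, which is at least 1. -/
theorem card_isPermColoring_and_le {k : ℕ} (hk : 2 ≤ k) (f g : V → Fin k) :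
    (#{σ : G.edgeSet → Equiv.Perm (Fin k) | IsPermColoring σ f ∧ IsPermColoring σ g} : ℝ) ≤
      (k.factorial : ℝ) ^ Fintype.card G.edgeSet *
        (((1 - 1 / k) ^ 2 * (1 + 1 / ((k : ℝ) - 1) ^ 3)) ^ Fintype.card G.edgeSet *
          ((1 - 1 / (k : ℝ))⁻¹) ^ (#{v | f v = g v}).choose 2) := by
  have hk2 : (2 : ℝ) ≤ k := by exact_mod_cast hk
  have hk1 : (0 : ℝ) < (k : ℝ) - 1 := by linarith
  have hp : 0 < 1 - 1 / (k : ℝ) := by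
    rw [sub_pos, div_lt_one (by linarith)]; linarith
  have hp1 : 1 ≤ (1 - 1 / (k : ℝ))⁻¹ := by
    refine (one_le_inv₀ hp).2 ?_
    have : 0 < 1 / (k : ℝ) := by positivity
    linarith
  have h : ({σ : G.edgeSet → Equiv.Perm (Fin k) | IsPermColoring σ f ∧ IsPermColoring σ g} :
      Finset _) = Fintype.piFinset fun e : G.edgeSet =>
        ({π | π (f e.1.inf) ≠ f e.1.sup ∧ π (g e.1.inf) ≠ g e.1.sup} :
          Finset (Equiv.Perm (Fin k))) := by
    ext σ; simp [IsPermColoring, forall_and]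
  rw [h, Fintype.card_piFinset, Nat.cast_prod]
  refine (prod_le_prod (fun _ _ => by positivity) fun e _ =>
    Equiv.Perm.card_filter_apply_ne_apply_ne_le hk _ _ _ _).trans ?_
  rw [prod_mul_distrib, prod_mul_distrib, prod_const, prod_const, card_univ, prod_ite, prod_const,
    prod_const_one, mul_one]
  gcongr
  convert card_edgeSet_filter_le G {v | f v = g v} using 4 <;> simp

theorem card_filter_eq_set (f : V → Fin k) (S : Finset V) :
    #{g : V → Fin k | ({v | f v = g v} : Finset V) = S} = (k - 1) ^ (Fintype.card V - #S) := by
  have h : ({g : V → Fin k | ({v | f v = g v} : Finset V) = S} : Finset _) =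
      Fintype.piFinset fun v => if v ∈ S then {f v} else univ.erase (f v) := by
    ext g
    simp only [mem_filter, mem_univ, true_and, Finset.ext_iff, Fintype.mem_piFinset]
    refine forall_congr' fun v => ?_
    by_cases hv : v ∈ S <;> simp [hv, eq_comm]
  rw [h, Fintype.card_piFinset, ← card_compl]
  simp only [apply_ite card, card_singleton, prod_ite, prod_const, one_pow, one_mul,
    card_erase_of_mem (mem_univ _), card_univ, Fintype.card_fin]
  congr 2
  ext; simp

/-- Group the maps `g` by their agreement set with `f`; off that set each value has k - 1 choices.
Divided by k^n this becomes a binomial expectation. -/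
theorem sum_pow_choose_two_card_eq (f : V → Fin k) (c : ℝ) :
    ∑ g : V → Fin k, c ^ (#{v | f v = g v}).choose 2 =
      ∑ s ∈ range (Fintype.card V + 1), ((Fintype.card V).choose s : ℝ) *
        (((k - 1 : ℕ) : ℝ) ^ (Fintype.card V - s) * c ^ s.choose 2) := by
  rw [← sum_fiberwise (univ : Finset (V → Fin k)) (fun g => ({v | f v = g v} : Finset V))]
  have h : ∀ S : Finset V, ∑ g : V → Fin k with ({v | f v = g v} : Finset V) = S,
      c ^ (#{v | f v = g v}).choose 2 =
        ((k - 1 : ℕ) : ℝ) ^ (Fintype.card V - #S) * c ^ (#S).choose 2 := fun S => by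
    rw [sum_congr rfl (g := fun _ => c ^ (#S).choose 2) fun g hg => by rw [(mem_filter.1 hg).2],
      sum_const, card_filter_eq_set, nsmul_eq_mul, Nat.cast_pow]
  simp only [h]
  rw [← powerset_univ, sum_powerset_apply_card (f := fun s =>
    ((k - 1 : ℕ) : ℝ) ^ (Fintype.card V - s) * c ^ s.choose 2), card_univ]
  simp

theorem probDPColorable_nonneg : 0 ≤ probDPColorable G k := ENNReal.toReal_nonneg

theorem probDPColorable_le_one : probDPColorable G k ≤ 1 := by
  rw [probDPColorable_eq]
  refine div_le_one_of_le₀ ?_ (by positivity)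
  have := card_le_univ ({σ : G.edgeSet → Equiv.Perm (Fin k) | ∃ f, IsPermColoring σ f} : Finset _)
  rw [Fintype.card_fun, Fintype.card_perm, Fintype.card_fin] at this
  exact_mod_cast this

/-- The first moment bound. -/
theorem probDPColorable_le :
    probDPColorable G k ≤ (k : ℝ) ^ Fintype.card V * (1 - 1 / k) ^ Fintype.card G.edgeSet := by
  rw [probDPColorable_eq, div_le_iff₀ (by positivity)]
  have h : ({σ : G.edgeSet → Equiv.Perm (Fin k) | ∃ f, IsPermColoring σ f} : Finset _) ⊆
      univ.biUnion fun f : V → Fin k =>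
        ({σ : G.edgeSet → Equiv.Perm (Fin k) | IsPermColoring σ f} : Finset _) := by
    intro σ; simp
  have h2 := (card_le_card h).trans card_biUnion_le
  refine (Nat.cast_le (α := ℝ).2 h2).trans ?_
  rw [Nat.cast_sum, sum_congr rfl fun f _ => card_isPermColoring G k f, sum_const, card_univ]
  simp only [Fintype.card_fun, Fintype.card_fin, nsmul_eq_mul, Nat.cast_pow]
  exact le_of_eq (by ring)

/-- The second moment bound. -/
theorem one_le_probDPColorable_mul {k : ℕ} (hk : 2 ≤ k) :
    1 ≤ probDPColorable G k * ((1 + 1 / ((k : ℝ) - 1) ^ 3) ^ Fintype.card G.edgeSet *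
      ∑ s ∈ range (Fintype.card V + 1), (1 / (k : ℝ)) ^ s *
        (1 - 1 / (k : ℝ)) ^ (Fintype.card V - s) * ((Fintype.card V).choose s : ℝ) *
          ((1 - 1 / (k : ℝ))⁻¹) ^ s.choose 2) := by
  have hk2 : (2 : ℝ) ≤ k := by exact_mod_cast hk
  have hk0 : (0 : ℝ) < k := by linarith
  have hk1 : (0 : ℝ) < (k : ℝ) - 1 := by linarith
  set p : ℝ := 1 - 1 / (k : ℝ) with hp_def
  have hp : 0 < p := by
    rw [hp_def, sub_pos, div_lt_one (by linarith)]; linarith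
  set n := Fintype.card V
  set M := Fintype.card G.edgeSet
  set r : ℝ := 1 + 1 / ((k : ℝ) - 1) ^ 3
  set N : ℝ := (k.factorial : ℝ) ^ M
  have hN : 0 < N := by positivity
  set Q : ℝ := ∑ s ∈ range (n + 1), (1 / (k : ℝ)) ^ s * p ^ (n - s) * (n.choose s : ℝ) *
    p⁻¹ ^ s.choose 2 with hQ_def
  let Ω := G.edgeSet → Equiv.Perm (Fin k)
  let X : Ω → ℝ := fun σ => #{f : V → Fin k | IsPermColoring σ f}
  let A : Finset Ω := {σ | ∃ f, IsPermColoring σ f}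
  have hX : ∀ σ, X σ = ∑ f : V → Fin k, if IsPermColoring σ f then (1 : ℝ) else 0 := fun σ => by
    simp only [X, sum_boole]
  have hEX : ∑ σ, X σ = (k : ℝ) ^ n * (N * p ^ M) := by
    simp only [hX]
    rw [sum_comm]
    simp only [sum_boole]
    rw [sum_congr rfl fun f _ => card_isPermColoring G k f, sum_const, card_univ]
    simp [n, N, M, p]
  have hQ : ∀ f : V → Fin k, ∑ g : V → Fin k, p⁻¹ ^ (#{v | f v = g v}).choose 2 =
      (k : ℝ) ^ n * Q := fun f => by
    rw [sum_pow_choose_two_card_eq, hQ_def, mul_sum]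
    refine sum_congr rfl fun s hs => ?_
    have hs : s ≤ n := Nat.lt_succ_iff.1 (mem_range.1 hs)
    have h1 : ((k - 1 : ℕ) : ℝ) = k * p := by
      rw [Nat.cast_sub (by omega), hp_def]; field_simp; simp
    have h2 : (k : ℝ) ^ n = k ^ s * k ^ (n - s) := by rw [← pow_add]; congr 1; omega
    have h3 : (k : ℝ) ^ s * (1 / (k : ℝ)) ^ s = 1 := by rw [← mul_pow]; field_simp; simp
    rw [h1, mul_pow, h2]
    linear_combination -((k : ℝ) ^ (n - s) * p ^ (n - s) * n.choose s * p⁻¹ ^ s.choose 2) * h3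
  have hEX2 : ∑ σ, X σ ^ 2 ≤ (k : ℝ) ^ n * (N * ((p ^ 2 * r) ^ M * ((k : ℝ) ^ n * Q))) := by
    have h1 : ∀ σ, X σ ^ 2 = ∑ f : V → Fin k, ∑ g : V → Fin k,
        if IsPermColoring σ f ∧ IsPermColoring σ g then (1 : ℝ) else 0 := fun σ => by
      rw [hX, sq, sum_mul_sum]
      refine sum_congr rfl fun f _ => sum_congr rfl fun g _ => ?_
      by_cases hf : IsPermColoring σ f <;> by_cases hg : IsPermColoring σ g <;> simp [hf, hg]
    simp only [h1]
    rw [sum_comm]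
    have h2 : ∀ f : V → Fin k, ∑ σ : Ω, ∑ g : V → Fin k,
        (if IsPermColoring σ f ∧ IsPermColoring σ g then (1 : ℝ) else 0) ≤
          N * ((p ^ 2 * r) ^ M * ((k : ℝ) ^ n * Q)) := fun f => by
      rw [sum_comm, ← hQ f, mul_sum, mul_sum]
      refine sum_le_sum fun g _ => ?_
      rw [sum_boole]
      exact card_isPermColoring_and_le G hk f g
    refine (sum_le_sum fun f _ => h2 f).trans (le_of_eq ?_)
    simp [n]
  -- Cauchy-Schwarz applied to X times the indicator of X > 0.
  have hCS : (∑ σ, X σ) ^ 2 ≤ #A * ∑ σ, X σ ^ 2 := by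
    have h := sum_mul_sq_le_sq_mul_sq (univ : Finset Ω)
      (fun σ => if ∃ f, IsPermColoring σ f then (1 : ℝ) else 0) X
    have h1 : ∀ σ, (if ∃ f, IsPermColoring σ f then (1 : ℝ) else 0) * X σ = X σ := fun σ => by
      split_ifs with hσ
      · simp
      · have : X σ = 0 := by
          simp only [X, Nat.cast_eq_zero, card_eq_zero]
          ext f; simp only [mem_filter, mem_univ, true_and, notMem_empty, iff_false]
          exact fun hf => hσ ⟨f, hf⟩
        simp [this]
    simpa only [h1, ite_pow, one_pow, ne_eq, OfNat.ofNat_ne_zero, not_false_eq_true, zero_pow,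
      sum_boole] using h
  have hP : probDPColorable G k = #A / N := probDPColorable_eq G k
  have hD : 0 < ((k : ℝ) ^ n * p ^ M) ^ 2 * N ^ 2 := by positivity
  refine le_of_mul_le_mul_left ?_ hD
  calc ((k : ℝ) ^ n * p ^ M) ^ 2 * N ^ 2 * 1 = (∑ σ, X σ) ^ 2 := by rw [hEX]; ring
    _ ≤ #A * ∑ σ, X σ ^ 2 := hCS
    _ ≤ #A * ((k : ℝ) ^ n * (N * ((p ^ 2 * r) ^ M * ((k : ℝ) ^ n * Q)))) := by gcongr
    _ = _ := by rw [hP, mul_pow, ← pow_mul, mul_comm 2 M, pow_mul]; field_simp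

end moments

/-! ### Estimating the second moment sum -/

theorem cast_choose_two_le (s : ℕ) : ((s.choose 2 : ℕ) : ℝ) ≤ (s : ℝ) ^ 2 / 2 := by
  rw [Nat.cast_choose_two]
  have : (0 : ℝ) ≤ s := s.cast_nonneg
  nlinarith

theorem inv_one_sub_one_div_le_exp {k : ℕ} {y : ℝ} (hy : 0 < y) (hyk : y ≤ (k : ℝ) - 1) :
    (1 - 1 / (k : ℝ))⁻¹ ≤ Real.exp (1 / y) := by
  have hk0 : (0 : ℝ) < k := by linarith
  have hk1 : (0 : ℝ) < (k : ℝ) - 1 := by linarith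
  calc (1 - 1 / (k : ℝ))⁻¹ = 1 / ((k : ℝ) - 1) + 1 := by field_simp; ring
    _ ≤ 1 / y + 1 := by gcongr
    _ ≤ _ := Real.add_one_le_exp _

/-- The term of size `s` in the second moment sum is at most `exp (s ^ 2 / (2 y))` times a binomial
probability. -/
theorem inv_one_sub_one_div_pow_choose_le {k : ℕ} {y : ℝ} (hy : 0 < y) (hyk : y ≤ (k : ℝ) - 1)
    (s : ℕ) : (1 - 1 / (k : ℝ))⁻¹ ^ s.choose 2 ≤ Real.exp ((s : ℝ) ^ 2 / (2 * y)) := by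
  have hp : 0 ≤ (1 - 1 / (k : ℝ))⁻¹ := by
    rw [inv_nonneg, sub_nonneg, div_le_one (by linarith)]; linarith
  calc (1 - 1 / (k : ℝ))⁻¹ ^ s.choose 2 ≤ Real.exp (1 / y) ^ s.choose 2 :=
        pow_le_pow_left₀ hp (inv_one_sub_one_div_le_exp hy hyk) _
    _ = Real.exp ((s.choose 2 : ℕ) / y) := by rw [← Real.exp_nat_mul]; congr 1; ring
    _ ≤ Real.exp ((s : ℝ) ^ 2 / 2 / y) := by gcongr; exact cast_choose_two_le s
    _ = _ := by rw [div_div]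

/-- Drop the power of 1 - 1/k, and use that n choose s is at most n^s/s! ≤ (en/s)^s. -/
theorem second_moment_term_le {k n s : ℕ} {y q : ℝ} (hy : 0 < y) (hyk : y ≤ (k : ℝ) - 1)
    (hs : 0 < s) (hq : Real.exp 1 * n / (s * y) * Real.exp (s / (2 * y)) ≤ q) :
    (1 / (k : ℝ)) ^ s * (1 - 1 / (k : ℝ)) ^ (n - s) * (n.choose s : ℝ) *
      (1 - 1 / (k : ℝ))⁻¹ ^ s.choose 2 ≤ q ^ s := by
  have hk0 : (0 : ℝ) < k := by linarith
  have hp0 : 0 ≤ 1 - 1 / (k : ℝ) := by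
    rw [sub_nonneg, div_le_one hk0]; linarith
  have hp1 : 1 - 1 / (k : ℝ) ≤ 1 := by
    have : 0 < 1 / (k : ℝ) := by positivity
    linarith
  have hs0 : (0 : ℝ) < s := by exact_mod_cast hs
  have hfact : (1 : ℝ) / s.factorial ≤ (Real.exp 1 / s) ^ s := by
    have h := Real.pow_div_factorial_le_exp (s : ℝ) hs0.le s
    rw [div_pow, ← Real.exp_nat_mul, mul_one, le_div_iff₀ (by positivity)]
    calc _ = (s : ℝ) ^ s / s.factorial := by ring
      _ ≤ _ := h
  have hchoose : (n.choose s : ℝ) ≤ (n * (Real.exp 1 / s)) ^ s := by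
    refine (Nat.choose_le_pow_div s n).trans ?_
    rw [mul_pow, div_eq_mul_one_div]
    gcongr
  calc (1 / (k : ℝ)) ^ s * (1 - 1 / (k : ℝ)) ^ (n - s) * (n.choose s : ℝ) *
        (1 - 1 / (k : ℝ))⁻¹ ^ s.choose 2
      ≤ (1 / y) ^ s * 1 * (n * (Real.exp 1 / s)) ^ s * Real.exp ((s : ℝ) ^ 2 / (2 * y)) := by
        gcongr
        · linarith
        · exact pow_le_one₀ hp0 hp1
        · exact inv_one_sub_one_div_pow_choose_le hy hyk s
    _ = (Real.exp 1 * n / (s * y) * Real.exp (s / (2 * y))) ^ s := by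
        have h : Real.exp ((s : ℝ) ^ 2 / (2 * y)) = Real.exp (s / (2 * y)) ^ s := by
          rw [← Real.exp_nat_mul]; congr 1; ring
        rw [h, mul_one, ← mul_pow, ← mul_pow]
        congr 2
        field_simp
    _ ≤ q ^ s := by gcongr

/-- For s ≤ m the weight is at most its bound at m, and the binomial probabilities sum to 1. For s >
m the terms are dominated by a geometric series. -/
theorem second_moment_sum_le {k n : ℕ} {y m q : ℝ} (hy : 0 < y) (hyk : y ≤ (k : ℝ) - 1)
    (hm : 0 ≤ m) (hq0 : 0 ≤ q) (hq : q ≤ 1 / 2)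
    (h : ∀ s : ℕ, s ≤ n → m < s → Real.exp 1 * n / (s * y) * Real.exp (s / (2 * y)) ≤ q) :
    ∑ s ∈ Finset.range (n + 1), (1 / (k : ℝ)) ^ s * (1 - 1 / (k : ℝ)) ^ (n - s) *
        (n.choose s : ℝ) * (1 - 1 / (k : ℝ))⁻¹ ^ s.choose 2 ≤
      Real.exp (m ^ 2 / (2 * y)) + 4 * q := by
  have hk0 : (0 : ℝ) < k := by linarith
  have hp0 : 0 ≤ 1 - 1 / (k : ℝ) := by
    rw [sub_nonneg, div_le_one hk0]; linarith
  -- Since s ≥ 1 and q ≤ 1/2, q^s ≤ q(1/2)^(s-1) = 2q(1/2)^s; summing over s gives 4q.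
  have hterm : ∀ s ∈ Finset.range (n + 1), (1 / (k : ℝ)) ^ s * (1 - 1 / (k : ℝ)) ^ (n - s) *
        (n.choose s : ℝ) * (1 - 1 / (k : ℝ))⁻¹ ^ s.choose 2 ≤
      (1 / (k : ℝ)) ^ s * (1 - 1 / (k : ℝ)) ^ (n - s) * (n.choose s : ℝ) *
        Real.exp (m ^ 2 / (2 * y)) + 2 * q * (1 / 2) ^ s := by
    intro s hs
    have hsn : s ≤ n := Nat.lt_succ_iff.1 (Finset.mem_range.1 hs)
    rcases le_or_gt (s : ℝ) m with hsm | hsm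
    · refine le_add_of_le_of_nonneg ?_ (by positivity)
      gcongr
      refine (inv_one_sub_one_div_pow_choose_le hy hyk s).trans ?_
      gcongr
    · have hs0 : 0 < s := by
        have : (0 : ℝ) < s := hm.trans_lt hsm
        exact_mod_cast this
      refine le_add_of_nonneg_of_le (by positivity)
        ((second_moment_term_le hy hyk hs0 (h s hsn hsm)).trans ?_)
      obtain ⟨t, rfl⟩ := Nat.exists_eq_succ_of_ne_zero hs0.ne'
      calc q ^ (t + 1) = q * q ^ t := pow_succ' q t
        _ ≤ q * (1 / 2) ^ t := by gcongr
        _ = _ := by rw [Nat.succ_eq_add_one, pow_succ]; ring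
  refine (Finset.sum_le_sum hterm).trans ?_
  rw [Finset.sum_add_distrib, ← Finset.sum_mul, ← Finset.mul_sum, ← add_pow]
  have := sum_geometric_two_le (n + 1)
  have h1 : (1 / (k : ℝ) + (1 - 1 / (k : ℝ))) ^ n = 1 := by simp
  rw [h1, one_mul]
  nlinarith

theorem card_edgeSet_top_fin (n : ℕ) [Fintype (⊤ : SimpleGraph (Fin n)).edgeSet] :
    Fintype.card (⊤ : SimpleGraph (Fin n)).edgeSet = n.choose 2 := by
  rw [← SimpleGraph.edgeFinset_card]
  convert SimpleGraph.card_edgeFinset_top_eq_card_choose_two (V := Fin n)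
  rw [Fintype.card_fin]

/-- The error bounds involve k only through a lower bound y for k - 1, so they apply to arbitrarily
large k. -/
theorem one_le_probDPColorable_top_mul {k n : ℕ} {y m q : ℝ} (hy : 0 < y)
    (hyk : y ≤ (k : ℝ) - 1) (hm : 0 ≤ m) (hq0 : 0 ≤ q) (hq : q ≤ 1 / 2)
    (h : ∀ s : ℕ, s ≤ n → m < s → Real.exp 1 * n / (s * y) * Real.exp (s / (2 * y)) ≤ q) :
    1 ≤ probDPColorable (⊤ : SimpleGraph (Fin n)) k *
      (Real.exp ((n : ℝ) ^ 2 / (2 * y ^ 3)) * (Real.exp (m ^ 2 / (2 * y)) + 4 * q)) := by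
  have hk : 2 ≤ k := by
    have : (1 : ℝ) < k := by linarith
    exact_mod_cast this
  refine (one_le_probDPColorable_mul (⊤ : SimpleGraph (Fin n)) hk).trans ?_
  have hk1 : (0 : ℝ) < (k : ℝ) - 1 := by linarith
  rw [card_edgeSet_top_fin, Fintype.card_fin]
  refine mul_le_mul_of_nonneg_left (mul_le_mul ?_ (second_moment_sum_le hy hyk hm hq0 hq h) ?_
    (Real.exp_nonneg _)) (probDPColorable_nonneg _ _)
  · calc (1 + 1 / ((k : ℝ) - 1) ^ 3) ^ n.choose 2
        ≤ Real.exp (1 / y ^ 3) ^ n.choose 2 := by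
          gcongr
          refine le_trans ?_ (Real.add_one_le_exp _)
          rw [add_comm]
          gcongr
      _ = Real.exp ((n.choose 2 : ℕ) / y ^ 3) := by rw [← Real.exp_nat_mul]; congr 1; ring
      _ ≤ Real.exp ((n : ℝ) ^ 2 / 2 / y ^ 3) := by gcongr; exact cast_choose_two_le n
      _ = _ := by rw [div_div]
  · have hp0 : 0 ≤ 1 - 1 / (k : ℝ) := by
      rw [sub_nonneg, div_le_one (by linarith)]; linarith
    positivity

/-! ### Asymptotics above the threshold -/

theorem tendsto_log_pow_div_nat (j : ℕ) :
    Tendsto (fun n : ℕ => Real.log n ^ j / (n : ℝ)) atTop (𝓝 0) := by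
  have := (Real.tendsto_pow_log_div_mul_add_atTop 1 0 j one_ne_zero).comp
    tendsto_natCast_atTop_atTop
  simpa [Function.comp_def] using this

theorem tendsto_log_sq_div_rpow_nat {r : ℝ} (hr : 0 < r) :
    Tendsto (fun n : ℕ => Real.log n ^ 2 / (n : ℝ) ^ r) atTop (𝓝 0) := by
  have h := ((isLittleO_log_rpow_rpow_atTop 2 hr).tendsto_div_nhds_zero).comp
    tendsto_natCast_atTop_atTop
  refine h.congr fun n => ?_
  simp only [Function.comp_apply]
  norm_cast

theorem dpColorableWhp_top {ε : ℝ} (hε : 0 < ε) {κ : ℕ → ℕ}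
    (hκ : ∀ᶠ n : ℕ in atTop, (1 + ε) * ((n : ℝ) / (2 * Real.log n)) ≤ (κ n : ℝ)) :
    DPColorableWhp (V := fun n => Fin n) (fun n => (⊤ : SimpleGraph (Fin n))) κ := by
  -- Any c strictly between 1/2 and (1 + ε)/2 serves: c > 1/2 makes r positive, and c < (1 + ε)/2
  -- leaves room to replace k by k - 1.
  set c : ℝ := (1 + ε / 2) / 2 with hc_def
  have hc : 1 / 2 < c := by rw [hc_def]; linarith
  have hc0 : 0 < c := by linarith
  set r : ℝ := 1 - 1 / (2 * c) with hr_def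
  have hr : 0 < r := by
    rw [hr_def, sub_pos, div_lt_one (by positivity)]; linarith
  have hlog : Tendsto (fun n : ℕ => Real.log n) atTop atTop :=
    Real.tendsto_log_atTop.comp tendsto_natCast_atTop_atTop
  -- The two summands control (ln n)² < s ≤ 2y and 2y < s ≤ n respectively, where y = cn/ln n.
  let q : ℕ → ℝ := fun n => Real.exp 1 ^ 2 / c * (Real.log n)⁻¹ +
    Real.exp 1 / (2 * c ^ 2) * (Real.log n ^ 2 / (n : ℝ) ^ r)
  let B : ℕ → ℝ := fun n => Real.exp (1 / (2 * c ^ 3) * (Real.log n ^ 3 / n)) *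
    (Real.exp (1 / (2 * c) * (Real.log n ^ 5 / n)) + 4 * q n)
  have hq : Tendsto q atTop (𝓝 0) := by
    simpa only [q, mul_zero, add_zero, Function.comp_apply] using
      ((tendsto_inv_atTop_zero.comp hlog).const_mul (Real.exp 1 ^ 2 / c)).add
        ((tendsto_log_sq_div_rpow_nat hr).const_mul (Real.exp 1 / (2 * c ^ 2)))
  have hB : Tendsto B atTop (𝓝 1) := by
    have h1 := (Real.continuous_exp.tendsto _).comp
      ((tendsto_log_pow_div_nat 3).const_mul (1 / (2 * c ^ 3)))
    have h2 := (Real.continuous_exp.tendsto _).comp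
      ((tendsto_log_pow_div_nat 5).const_mul (1 / (2 * c)))
    have h3 := h1.mul (h2.add (hq.const_mul 4))
    simpa [B, Function.comp_def] using h3
  have hBinv : Tendsto (fun n => (B n)⁻¹) atTop (𝓝 1) := by simpa using hB.inv₀ one_ne_zero
  refine tendsto_of_tendsto_of_tendsto_of_le_of_le' hBinv tendsto_const_nhds ?_
    (Eventually.of_forall fun n => probDPColorable_le_one _ _)
  have hsmall : ∀ᶠ n : ℕ in atTop, Real.log n / (n : ℝ) < ε / 4 := by
    simpa using (tendsto_log_pow_div_nat 1).eventually_lt_const (show (0 : ℝ) < ε / 4 by linarith)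
  filter_upwards [hκ, hsmall, hq.eventually_le_const (show (0 : ℝ) < 1 / 2 by norm_num),
    hlog.eventually_gt_atTop 0, eventually_gt_atTop 0] with n hκn hsm hqn hL hn
  have hn0 : (0 : ℝ) < n := by exact_mod_cast hn
  set L := Real.log n with hL_def
  have hy : 0 < c * n / L := by positivity
  have hyk : c * n / L ≤ (κ n : ℝ) - 1 := by
    have h1 : 1 ≤ ε * n / (4 * L) := by
      rw [le_div_iff₀ (by positivity)]
      rw [div_lt_iff₀ hn0] at hsm
      linarith
    have h2 : (1 + ε) * ((n : ℝ) / (2 * L)) = c * n / L + ε * n / (4 * L) := by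
      rw [hc_def]; field_simp; ring
    linarith
  have hq1 : (0 : ℝ) ≤ Real.exp 1 ^ 2 / c * L⁻¹ := by positivity
  have hq2 : 0 ≤ Real.exp 1 / (2 * c ^ 2) * (L ^ 2 / (n : ℝ) ^ r) := by positivity
  have hrpow : Real.exp (n / (2 * (c * n / L))) / n = 1 / (n : ℝ) ^ r := by
    rw [Real.rpow_def_of_pos hn0, one_div, ← Real.exp_neg, div_eq_iff hn0.ne']
    have hexp : (n : ℝ) = Real.exp L := (Real.exp_log hn0).symm
    calc _ = Real.exp (-(L * r) + L) := ?_
      _ = _ := by rw [Real.exp_add, ← hexp]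
    rw [hr_def]
    congr 1
    field_simp
    ring
  -- The cutoff m = (ln n)² is large enough that n/(my) tends to 0 and small enough that m²/y does.
  have hmain := one_le_probDPColorable_top_mul (n := n) (m := L ^ 2) (q := q n) hy hyk
    (by positivity) (add_nonneg hq1 hq2) hqn ?_
  · have hBn : Real.exp ((n : ℝ) ^ 2 / (2 * (c * n / L) ^ 3)) *
        (Real.exp ((L ^ 2) ^ 2 / (2 * (c * n / L))) + 4 * q n) = B n := by
      simp only [B]
      rw [← hL_def]
      congr 3
      · field_simp
      · field_simp
    rw [hBn] at hmain
    have hBpos : 0 < B n := by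
      have : 0 ≤ q n := add_nonneg hq1 hq2
      positivity
    rw [inv_le_iff_one_le_mul₀ hBpos]
    exact hmain
  · intro s hsn hms
    have hs0 : (0 : ℝ) < s := lt_trans (by positivity) hms
    have hsn' : (s : ℝ) ≤ n := by exact_mod_cast hsn
    rcases le_or_gt (s : ℝ) (2 * (c * n / L)) with hs | hs
    · refine le_add_of_le_of_nonneg ?_ hq2
      calc Real.exp 1 * n / (s * (c * n / L)) * Real.exp (s / (2 * (c * n / L)))
          ≤ Real.exp 1 * n / (L ^ 2 * (c * n / L)) * Real.exp 1 := by
            gcongr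
            exact div_le_one_of_le₀ hs (by positivity)
        _ = Real.exp 1 ^ 2 / c * L⁻¹ := by field_simp
    · refine le_add_of_nonneg_of_le hq1 ?_
      calc Real.exp 1 * n / (s * (c * n / L)) * Real.exp (s / (2 * (c * n / L)))
          ≤ Real.exp 1 * n / (2 * (c * n / L) * (c * n / L)) *
              Real.exp (n / (2 * (c * n / L))) := by gcongr
        _ = Real.exp 1 / (2 * c ^ 2) * L ^ 2 * (Real.exp (n / (2 * (c * n / L))) / n) := by
            generalize Real.exp (n / (2 * (c * n / L))) = E
            field_simp
        _ = _ := by rw [hrpow]; ring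

/-! ### Asymptotics below the threshold -/

theorem nonDPColorableWhp_top {ε : ℝ} (hε : 0 < ε) {κ : ℕ → ℕ}
    (hκ : ∀ᶠ n : ℕ in atTop, (κ n : ℝ) ≤ (1 - ε) * ((n : ℝ) / (2 * Real.log n))) :
    NonDPColorableWhp (V := fun n => Fin n) (fun n => (⊤ : SimpleGraph (Fin n))) κ := by
  have hlog : Tendsto (fun n : ℕ => Real.log n) atTop atTop :=
    Real.tendsto_log_atTop.comp tendsto_natCast_atTop_atTop
  have hlarge : ∀ᶠ n : ℕ in atTop, 2 ≤ ε * (n : ℝ) :=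
    (tendsto_natCast_atTop_atTop.const_mul_atTop hε).eventually_ge_atTop 2
  refine tendsto_of_tendsto_of_tendsto_of_le_of_le' tendsto_const_nhds
    (tendsto_inv_atTop_zero.comp tendsto_natCast_atTop_atTop)
    (Eventually.of_forall fun n => probDPColorable_nonneg _ _) ?_
  filter_upwards [hκ, hlarge, hlog.eventually_ge_atTop 1, eventually_gt_atTop 0]
    with n hκn hεn hL hn
  refine (probDPColorable_le _ _).trans ?_
  rw [card_edgeSet_top_fin, Fintype.card_fin]
  simp only [Function.comp_apply]
  have hn0 : (0 : ℝ) < n := by exact_mod_cast hn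
  rcases (κ n).eq_zero_or_pos with hk | hk
  -- With k = 0 the convention 1/0 = 0 would spoil the exponential estimate, but the factor 0^n
  -- already vanishes.
  · rw [hk, Nat.cast_zero, zero_pow hn.ne', zero_mul]
    positivity
  have hk0 : (0 : ℝ) < κ n := by exact_mod_cast hk
  have hk1 : (1 : ℝ) ≤ κ n := by exact_mod_cast hk
  set L := Real.log n with hL_def
  have hL0 : 0 < L := by linarith
  have hkn : (κ n : ℝ) ≤ n := by
    refine hκn.trans ?_
    rw [mul_div_assoc', div_le_iff₀ (by positivity)]
    nlinarith
  have hp0 : 0 ≤ 1 - 1 / (κ n : ℝ) := by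
    rw [sub_nonneg, div_le_one hk0]; exact hk1
  have hkL : 2 * L * κ n ≤ (1 - ε) * n := by
    rw [mul_div_assoc', le_div_iff₀ (by positivity)] at hκn
    linarith
  calc (κ n : ℝ) ^ n * (1 - 1 / (κ n : ℝ)) ^ n.choose 2
      ≤ Real.exp L ^ n * Real.exp (-(1 / (κ n : ℝ))) ^ n.choose 2 := by
        gcongr
        · rwa [hL_def, Real.exp_log hn0]
        · exact Real.one_sub_le_exp_neg _
    _ = Real.exp (n * L - n * (n - 1) / (2 * κ n)) := by
        rw [← Real.exp_nat_mul, ← Real.exp_nat_mul, ← Real.exp_add, Nat.cast_choose_two]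
        congr 1
        field_simp
        ring
    _ ≤ Real.exp (-L) := by
        refine Real.exp_le_exp.2 ?_
        -- This reduces to (n + 1)(1 - ε) ≤ n - 1, which follows from εn ≥ 2.
        have : (n + 1) * L ≤ n * (n - 1) / (2 * κ n) := by
          rw [le_div_iff₀ (by positivity)]
          nlinarith
        linarith
    _ = (n : ℝ)⁻¹ := by rw [Real.exp_neg, hL_def, Real.exp_log hn0]

theorem corollary1p4 :
    IsSharpDPThreshold (V := fun n => Fin n) (fun n => (⊤ : SimpleGraph (Fin n)))
      (fun n => (n : ℝ) / (2 * Real.log n)) := by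
  exact fun _ hε _ => ⟨nonDPColorableWhp_top hε, dpColorableWhp_top hε⟩
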